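/- For nonnegative integers $j,n$ let $\vartheta_2(j,n)$ be the number of $t\in\{0,\ldots,n\}$ such that $2^j$ exactly divides $\binom nt$. Let $W$ be the set of binary words $w=w_{\mu-1}\cdots w_0\in\{0,1\}^\mu$ with $\mu\ge 2$, $w_{\mu-1}=1$ and $w_0=0$, and for $w\in W$ let $|n|_w$ be the number of (possibly overlapping) occurrences of $w$ as a factor of the binary expansion of $n$, padded with zeros on the left. For every $j\ge 0$ there is a unique polynomial $P_j$ with real coefficients in the variables $X_w$ $(w\in W)$ such that \[P_j\bigl((|n|_w)_{w\in W}\bigr)=\frac{\vartheta_2(j,n)}{\vartheta_2(0,n)}\qquad\text{for all } n\ge 0;\] it has total degree $j$ and involves only variables $X_w$ with $w$ of length at most $j+1$. Let $c_j$ be the coefficient of the monomial $X_{10}$ in $P_j$. Then for all $j\ge 0$ \[c_j=[x^j]\log\Bigl(1+\frac x2\Bigr),\] and consequently the series $\sum_{j\ge 0}c_j$ converges absolutely, with \[\sum_{j\ge 0}c_j=\log\frac 32 .\] -/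

import Mathlib

/-- The number `ϑ_p(j, n)` of entries of the `n`-th row of Pascal's triangle that are exactly
divisible by `p ^ j`. -/
def rowCount (p j n : ℕ) : ℕ :=
  ((Finset.range (n + 1)).filter fun t => padicValNat p (n.choose t) = j).card

/-- The word `n_{i+μ-1} ⋯ n_i` of base-`p` digits of `n` (padded with zeros on the left); like all
words below it is written with the most significant digit first. -/
def digitBlock (p n i μ : ℕ) : List ℕ :=
  ((List.range μ).map fun k => n / p ^ (i + k) % p).reverse

/-- `|n|_w`: the number of (possibly overlapping) occurrences of the word `w` as a factor of the
base-`p` expansion of `n`, padded with infinitely many zeros on the left. (The set is finite when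
`w` has a nonzero digit.) -/
noncomputable def factorCount (p : ℕ) (w : List ℕ) (n : ℕ) : ℕ :=
  {i : ℕ | digitBlock p n i w.length = w}.ncard

/-- The admissible words `w_{μ-1} ⋯ w_0` over the digits `0, …, p-1`: those with `μ ≥ 2`,
`w_{μ-1} ≠ 0` and `w_0 ≠ p - 1`. -/
def IsAdmissible (p : ℕ) (w : List ℕ) : Prop :=
  2 ≤ w.length ∧ (∀ d ∈ w, d < p) ∧ w.head? ≠ some 0 ∧ w.getLast? ≠ some (p - 1)

/-- The set `W` of admissible words, which index the variables `X_w`. -/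
abbrev AdmissibleWord (p : ℕ) : Type := {w : List ℕ // IsAdmissible p w}

/-- `P((|n|_w)_{w ∈ W}) = ϑ_p(j, n) / ϑ_p(0, n)` for all `n ≥ 0`. -/
def RepresentsRow (p j : ℕ) (P : MvPolynomial (AdmissibleWord p) ℝ) : Prop :=
  ∀ n : ℕ, MvPolynomial.eval (fun w => (factorCount p w.1 n : ℝ)) P
    = (rowCount p j n : ℝ) / (rowCount p 0 n : ℝ)

/-- `P` is a polynomial of degree `j` in the variables `X_w`, where `w` ranges over the set `W_j` of
admissible words of length at most `j + 1`, and it represents `ϑ_p(j, n) / ϑ_p(0, n)`. -/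
structure IsRowPolynomial (p j : ℕ) (P : MvPolynomial (AdmissibleWord p) ℝ) : Prop where
  totalDegree_eq : P.totalDegree = j
  length_le : ∀ w ∈ P.vars, w.1.length ≤ j + 1
  represents : RepresentsRow p j P

/-- The binary word `10`. -/
def wordOneZero : AdmissibleWord 2 := ⟨[1, 0], by simp [IsAdmissible]⟩

/-- The formal power series `log (1 + x / 2)`. -/
noncomputable def logOneAddHalf : PowerSeries ℝ :=
  (PowerSeries.log ℝ).subst (PowerSeries.C (1 / 2 : ℝ) * PowerSeries.X)

/-! By Kummer's theorem, splitting a row by the parity of the column gives recurrences for the pair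
(`rowGen`, `oddGen`) under appending a binary digit. After division by `ϑ₂(0, n)`, the pair for `n`
is obtained by linear maps over power series: digit 0 sends `(R, O)` to `(R + O, 2XO)`, digit 1
sends it to `(R, X(R + O)/2)`. Their determinants are `2X` and `X/2`, so the influence of a leading
digit on that of a trailing digit decays like a power of `X`.

Telescoping over subwords turns this into `rowSeries n = ∏ F_w ^ |n|_w` (`rowSeries_eq_prod`), where
`F_w` is `factorOf w` and `F_w ≡ 1` modulo `X ^ (|w| - 1)` (`X_pow_dvd_factorOf_sub_one`). Hence
only words of length at most `j + 1` affect the coefficient of `X ^ j`. The coefficient of `X ^ m`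
in `F ^ a` is a polynomial in `a` of degree at most `m`; replacing each exponent by a variable `X_w`
gives `rowPoly`.

Setting every variable except `X_10` to zero leaves `(1 + x/2) ^ X_10 = exp(X_10 log(1 + x/2))`,
whose part linear in `X_10` is the logarithm. The coefficient of `X_10 ^ j` is nonzero, so the
degree is exactly `j`.

Uniqueness is algebraic independence of the counts: concatenation makes suitable count vectors an
additive monoid, a polynomial vanishing there vanishes on its span, and the span contains every unit
vector needed (`exists_factorCount_detecting`). -/

/-- The row generating series `∑ₜ X ^ ν₂(n choose t)`. -/
noncomputable def rowGen (n : ℕ) : PowerSeries ℝ :=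
  ∑ t ∈ Finset.range (n + 1), PowerSeries.X ^ padicValNat 2 (n.choose t)

/-- The part of `rowGen (2 * n)` coming from odd column indices. -/
noncomputable def oddGen (n : ℕ) : PowerSeries ℝ :=
  ∑ s ∈ Finset.range n, PowerSeries.X ^ padicValNat 2 ((2 * n).choose (2 * s + 1))

/-! ### Digit sums, valuations and recurrences for Pascal rows -/

lemma sum_digits_two_mul (n : ℕ) : (Nat.digits 2 (2 * n)).sum = (Nat.digits 2 n).sum := by
  rcases Nat.eq_zero_or_pos n with rfl | h
  · simp
  · rw [Nat.digits_def' (by norm_num) (by omega)]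
    simp

lemma sum_digits_two_mul_add_one (n : ℕ) :
    (Nat.digits 2 (2 * n + 1)).sum = (Nat.digits 2 n).sum + 1 := by
  rw [Nat.digits_def' (by norm_num) (by omega)]
  have h1 : (2 * n + 1) % 2 = 1 := by omega
  have h2 : (2 * n + 1) / 2 = n := by omega
  rw [h1, h2, List.sum_cons, add_comm]

/-- Legendre's formula, applied to the three factorials of the binomial coefficient. -/
lemma sum_digits_add_padicValNat_choose {n k : ℕ} (h : k ≤ n) :
    (Nat.digits 2 n).sum + padicValNat 2 (n.choose k) =
      (Nat.digits 2 k).sum + (Nat.digits 2 (n - k)).sum := by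
  have key := congrArg (padicValNat 2) (Nat.choose_mul_factorial_mul_factorial h)
  rw [padicValNat.mul (mul_ne_zero (Nat.choose_pos h).ne' k.factorial_ne_zero)
    (n - k).factorial_ne_zero, padicValNat.mul (Nat.choose_pos h).ne' k.factorial_ne_zero] at key
  have h1 := sub_one_mul_padicValNat_factorial (p := 2) n
  have h2 := sub_one_mul_padicValNat_factorial (p := 2) k
  have h3 := sub_one_mul_padicValNat_factorial (p := 2) (n - k)
  have h4 := Nat.digit_sum_le 2 n
  have h5 := Nat.digit_sum_le 2 k
  have h6 := Nat.digit_sum_le 2 (n - k)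
  omega

lemma padicValNat_choose_double {n s : ℕ} (h : s ≤ n) :
    padicValNat 2 ((2 * n).choose (2 * s)) = padicValNat 2 (n.choose s) := by
  have h1 := sum_digits_add_padicValNat_choose (n := 2 * n) (k := 2 * s) (by omega)
  have h2 := sum_digits_add_padicValNat_choose h
  rw [show 2 * n - 2 * s = 2 * (n - s) by omega] at h1
  simp only [sum_digits_two_mul] at h1
  omega

lemma padicValNat_choose_odd_even {n s : ℕ} (h : s ≤ n) :
    padicValNat 2 ((2 * n + 1).choose (2 * s)) = padicValNat 2 (n.choose s) := by
  have h1 := sum_digits_add_padicValNat_choose (n := 2 * n + 1) (k := 2 * s) (by omega)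
  have h2 := sum_digits_add_padicValNat_choose h
  rw [show 2 * n + 1 - 2 * s = 2 * (n - s) + 1 by omega] at h1
  simp only [sum_digits_two_mul, sum_digits_two_mul_add_one] at h1
  omega

lemma padicValNat_choose_odd_odd {n s : ℕ} (h : s ≤ n) :
    padicValNat 2 ((2 * n + 1).choose (2 * s + 1)) = padicValNat 2 (n.choose s) := by
  have h1 := sum_digits_add_padicValNat_choose (n := 2 * n + 1) (k := 2 * s + 1) (by omega)
  have h2 := sum_digits_add_padicValNat_choose h
  rw [show 2 * n + 1 - (2 * s + 1) = 2 * (n - s) by omega] at h1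
  simp only [sum_digits_two_mul, sum_digits_two_mul_add_one] at h1
  omega

/-- Both parts `2s + 1` and `2(n - 1 - s) + 1` of `2n` end in the digit 1, whence the 2. -/
lemma sum_digits_add_padicValNat_choose_even_odd {n s : ℕ} (h : s < n) :
    (Nat.digits 2 n).sum + padicValNat 2 ((2 * n).choose (2 * s + 1)) =
      (Nat.digits 2 s).sum + (Nat.digits 2 (n - 1 - s)).sum + 2 := by
  have h1 := sum_digits_add_padicValNat_choose (n := 2 * n) (k := 2 * s + 1) (by omega)
  rw [show 2 * n - (2 * s + 1) = 2 * (n - 1 - s) + 1 by omega] at h1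
  simp only [sum_digits_two_mul, sum_digits_two_mul_add_one] at h1
  omega

lemma sum_range_two_mul {M : Type*} [AddCommMonoid M] (f : ℕ → M) (n : ℕ) :
    ∑ t ∈ Finset.range (2 * n), f t =
      ∑ s ∈ Finset.range n, f (2 * s) + ∑ s ∈ Finset.range n, f (2 * s + 1) := by
  induction n with
  | zero => simp
  | succ n ih =>
    rw [Nat.mul_succ, Finset.sum_range_succ, Finset.sum_range_succ, ih, Finset.sum_range_succ,
      Finset.sum_range_succ]
    abel

lemma rowGen_two_mul_add_one (n : ℕ) : rowGen (2 * n + 1) = 2 * rowGen n := by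
  unfold rowGen
  rw [show 2 * n + 1 + 1 = 2 * (n + 1) by ring, sum_range_two_mul, two_mul (Finset.sum _ _)]
  refine congrArg₂ _ (Finset.sum_congr rfl fun s hs => ?_) (Finset.sum_congr rfl fun s hs => ?_)
  · rw [padicValNat_choose_odd_even (by simpa [Nat.lt_succ_iff] using hs)]
  · rw [padicValNat_choose_odd_odd (by simpa [Nat.lt_succ_iff] using hs)]

lemma rowGen_two_mul (n : ℕ) : rowGen (2 * n) = rowGen n + oddGen n := by
  unfold rowGen oddGen
  rw [Finset.sum_range_succ, sum_range_two_mul, Finset.sum_range_succ, Nat.choose_self,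
    Nat.choose_self, add_right_comm]
  congr 2
  refine Finset.sum_congr rfl fun s hs => ?_
  rw [padicValNat_choose_double (Finset.mem_range.1 hs).le]

lemma oddGen_two_mul_add_one (n : ℕ) :
    oddGen (2 * n + 1) = PowerSeries.X * (rowGen n + oddGen n) := by
  rw [← rowGen_two_mul, oddGen, rowGen, Finset.mul_sum]
  refine Finset.sum_congr rfl fun s hs => ?_
  have hs := Finset.mem_range.1 hs
  rw [← pow_succ']
  congr 1
  have h1 := sum_digits_add_padicValNat_choose_even_odd hs
  have h2 := sum_digits_add_padicValNat_choose (n := 2 * n) (k := s) (by omega)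
  rw [show 2 * n + 1 - 1 - s = 2 * n - s by omega] at h1
  simp only [sum_digits_two_mul, sum_digits_two_mul_add_one] at h1 h2
  omega

lemma oddGen_two_mul (n : ℕ) : oddGen (2 * n) = 2 * (PowerSeries.X * oddGen n) := by
  unfold oddGen
  rw [sum_range_two_mul, two_mul (PowerSeries.X * _), Finset.mul_sum]
  refine congrArg₂ _ (Finset.sum_congr rfl fun s hs => ?_) (Finset.sum_congr rfl fun s hs => ?_)
  all_goals
    have hs := Finset.mem_range.1 hs
    rw [← pow_succ']
    congr 1
    have h2 := sum_digits_add_padicValNat_choose_even_odd hs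
  · have h1 := sum_digits_add_padicValNat_choose_even_odd (n := 2 * n) (s := 2 * s) (by omega)
    rw [show 2 * n - 1 - 2 * s = 2 * (n - 1 - s) + 1 by omega] at h1
    simp only [sum_digits_two_mul, sum_digits_two_mul_add_one] at h1
    omega
  · have h1 := sum_digits_add_padicValNat_choose_even_odd (n := 2 * n) (s := 2 * s + 1) (by omega)
    rw [show 2 * n - 1 - (2 * s + 1) = 2 * (n - 1 - s) by omega] at h1
    simp only [sum_digits_two_mul, sum_digits_two_mul_add_one] at h1
    omega

lemma coeff_rowGen (j n : ℕ) : PowerSeries.coeff j (rowGen n) = rowCount 2 j n := by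
  simp [rowGen, rowCount, PowerSeries.coeff_X_pow, eq_comm]

lemma constantCoeff_rowGen_ne_zero (n : ℕ) : PowerSeries.constantCoeff (rowGen n) ≠ 0 := by
  rw [← PowerSeries.coeff_zero_eq_constantCoeff_apply, coeff_rowGen, Nat.cast_ne_zero]
  exact Finset.card_ne_zero_of_mem (a := 0) (by simp)

lemma constantCoeff_oddGen (n : ℕ) : PowerSeries.constantCoeff (oddGen n) = 0 := by
  rcases Nat.even_or_odd' n with ⟨m, rfl | rfl⟩
  · simp [oddGen_two_mul]
  · simp [oddGen_two_mul_add_one]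

/-! ### Normalised series and transfer matrices -/

/-- The normalised row series `∑ⱼ ϑ₂(j, n) / ϑ₂(0, n) X ^ j`. -/
noncomputable def rowSeries (n : ℕ) : PowerSeries ℝ :=
  PowerSeries.C (PowerSeries.constantCoeff (rowGen n))⁻¹ * rowGen n

/-- The difference `rowSeries (2 * n) - rowSeries n`. -/
noncomputable def oddSeries (n : ℕ) : PowerSeries ℝ :=
  PowerSeries.C (PowerSeries.constantCoeff (rowGen n))⁻¹ * oddGen n

lemma coeff_rowSeries (j n : ℕ) :
    PowerSeries.coeff j (rowSeries n) = (rowCount 2 j n : ℝ) / rowCount 2 0 n := by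
  rw [rowSeries, PowerSeries.coeff_C_mul, coeff_rowGen,
    ← PowerSeries.coeff_zero_eq_constantCoeff_apply, coeff_rowGen, div_eq_inv_mul]

lemma constantCoeff_rowSeries (n : ℕ) : PowerSeries.constantCoeff (rowSeries n) = 1 := by
  simp [rowSeries, constantCoeff_rowGen_ne_zero]

lemma rowSeries_two_mul (n : ℕ) : rowSeries (2 * n) = rowSeries n + oddSeries n := by
  simp [rowSeries, oddSeries, rowGen_two_mul, constantCoeff_oddGen, mul_add]

lemma C_mul_two (c : ℝ) : PowerSeries.C (c * 2⁻¹) * 2 = PowerSeries.C c := by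
  rw [← map_ofNat PowerSeries.C 2, ← map_mul]
  congr 1
  simp

lemma rowSeries_two_mul_add_one (n : ℕ) : rowSeries (2 * n + 1) = rowSeries n := by
  rw [rowSeries, rowGen_two_mul_add_one, map_mul, map_ofNat, mul_inv_rev, ← mul_assoc, C_mul_two,
    rowSeries]

lemma oddSeries_two_mul (n : ℕ) : oddSeries (2 * n) = 2 * PowerSeries.X * oddSeries n := by
  simp only [oddSeries, rowGen_two_mul, oddGen_two_mul, map_add, constantCoeff_oddGen, add_zero]
  ring

lemma oddSeries_two_mul_add_one (n : ℕ) :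
    oddSeries (2 * n + 1) =
      PowerSeries.C 2⁻¹ * PowerSeries.X * (rowSeries n + oddSeries n) := by
  simp only [oddSeries, rowSeries, rowGen_two_mul_add_one, oddGen_two_mul_add_one, map_mul,
    map_ofNat, mul_inv_rev]
  ring

lemma rowSeries_zero : rowSeries 0 = 1 := by
  simp [rowSeries, rowGen]

lemma oddSeries_zero : oddSeries 0 = 0 := by
  simp [oddSeries, oddGen]

lemma rowSeries_one : rowSeries 1 = 1 := by
  rw [← rowSeries_zero]
  exact rowSeries_two_mul_add_one 0

lemma rowSeries_two : rowSeries 2 = 1 + PowerSeries.C 2⁻¹ * PowerSeries.X := by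
  have h := rowSeries_two_mul 1
  have h' := oddSeries_two_mul_add_one 0
  rw [mul_zero, zero_add, rowSeries_zero, oddSeries_zero] at h'
  rw [mul_one, rowSeries_one, h'] at h
  rw [h]
  ring

/-- Prepending the digit `1` at position `k` changes the pair `(rowSeries, oddSeries)` by a matrix
whose determinant is divisible by `X ^ (k + 1)`. -/
lemma X_pow_dvd_det (k : ℕ) : ∀ m < 2 ^ k,
    PowerSeries.X ^ (k + 1) ∣
      rowSeries (2 ^ k + m) * oddSeries m - rowSeries m * oddSeries (2 ^ k + m) := by
  induction k with
  | zero =>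
    intro m hm
    obtain rfl : m = 0 := by simpa using hm
    have h' := oddSeries_two_mul_add_one 0
    rw [mul_zero, zero_add, rowSeries_zero, oddSeries_zero] at h'
    rw [pow_zero, add_zero, rowSeries_one, rowSeries_zero, oddSeries_zero, h']
    exact ⟨-PowerSeries.C 2⁻¹, by ring⟩
  | succ k ih =>
    intro m hm
    -- Appending one digit to both numbers applies the same matrix to both pairs. Its determinant,
    -- `2X` or `X/2`, supplies the additional factor `X`.
    rcases Nat.even_or_odd' m with ⟨l, rfl | rfl⟩
    · obtain ⟨q, hq⟩ := ih l (by omega)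
      rw [show 2 ^ (k + 1) + 2 * l = 2 * (2 ^ k + l) by ring]
      simp only [rowSeries_two_mul, oddSeries_two_mul]
      exact ⟨2 * q, by linear_combination 2 * PowerSeries.X * hq⟩
    · obtain ⟨q, hq⟩ := ih l (by omega)
      rw [show 2 ^ (k + 1) + (2 * l + 1) = 2 * (2 ^ k + l) + 1 by ring]
      simp only [rowSeries_two_mul_add_one, oddSeries_two_mul_add_one]
      exact ⟨PowerSeries.C 2⁻¹ * q,
        by linear_combination PowerSeries.C 2⁻¹ * PowerSeries.X * hq⟩

/-! ### Factors attached to words -/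

/-- The quotient `U_w U_{w_LR} / (U_{w_L} U_{w_R})` for the word with value `v` and length
`k + 1`. -/
noncomputable def wordFactor (k v : ℕ) : PowerSeries ℝ :=
  rowSeries v * rowSeries (v % 2 ^ k / 2) * (rowSeries (v % 2 ^ k) * rowSeries (v / 2))⁻¹

lemma constantCoeff_mul_rowSeries (a b : ℕ) :
    PowerSeries.constantCoeff (rowSeries a * rowSeries b) = 1 := by
  simp [constantCoeff_rowSeries]

lemma constantCoeff_wordFactor (k v : ℕ) : PowerSeries.constantCoeff (wordFactor k v) = 1 := by
  simp [wordFactor, constantCoeff_rowSeries, PowerSeries.constantCoeff_inv]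

/-- For a word ending in 0, numerator minus denominator of `wordFactor` collapses to minus the
determinant in `X_pow_dvd_det`. -/
lemma X_pow_dvd_wordFactor_sub_one {k v : ℕ} (h1 : 2 ^ k ≤ v) (h2 : v < 2 ^ (k + 1))
    (hv : v % 2 = 0) (hk : k ≠ 0) : PowerSeries.X ^ k ∣ wordFactor k v - 1 := by
  obtain ⟨k, rfl⟩ := Nat.exists_eq_succ_of_ne_zero hk
  obtain ⟨m, rfl⟩ : ∃ m, v = 2 * (2 ^ k + m) := ⟨v / 2 - 2 ^ k, by simp only [pow_succ] at *; omega⟩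
  have hm : m < 2 ^ k := by simp only [pow_succ] at *; omega
  obtain ⟨q, hq⟩ := X_pow_dvd_det k m hm
  have hmod : 2 * (2 ^ k + m) % 2 ^ (k + 1) = 2 * m := by
    rw [show 2 * (2 ^ k + m) = 2 * m + 2 ^ (k + 1) by ring, Nat.add_mod_right,
      Nat.mod_eq_of_lt (by rw [pow_succ]; omega)]
  set D := rowSeries (2 * m) * rowSeries (2 ^ k + m) with hD
  have hDi : D * D⁻¹ = 1 := PowerSeries.mul_inv_cancel _ (by
    rw [hD, constantCoeff_mul_rowSeries]; exact one_ne_zero)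
  refine ⟨-q * D⁻¹, ?_⟩
  rw [Nat.succ_eq_add_one, wordFactor, hmod, Nat.mul_div_cancel_left _ two_pos,
    Nat.mul_div_cancel_left _ two_pos, ← hD, ← hDi, ← sub_mul]
  simp only [hD, rowSeries_two_mul] at *
  linear_combination (-1) * ((rowSeries m + oddSeries m) * rowSeries (2 ^ k + m))⁻¹ * hq

/-! ### Words as positive even integers, and their occurrences -/

/-- The number with binary expansion `w`. -/
def wordVal (w : AdmissibleWord 2) : ℕ := Nat.ofDigits 2 w.1.reverse

lemma length_digitBlock (p n i μ : ℕ) : (digitBlock p n i μ).length = μ := by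
  simp [digitBlock]

lemma lt_of_mem_digitBlock {n i μ d : ℕ} (h : d ∈ digitBlock 2 n i μ) : d < 2 := by
  simp only [digitBlock, List.mem_reverse, List.mem_map] at h
  obtain ⟨k, -, rfl⟩ := h
  exact Nat.mod_lt _ two_pos

lemma ofDigits_digitBlock (n i μ : ℕ) :
    Nat.ofDigits 2 (digitBlock 2 n i μ).reverse = n / 2 ^ i % 2 ^ μ := by
  induction μ with
  | zero => simp [digitBlock, Nat.mod_one]
  | succ μ ih =>
    simp only [digitBlock, List.reverse_reverse] at ih ⊢
    rw [List.range_succ, List.map_append, Nat.ofDigits_append, ih, Nat.mod_pow_succ]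
    simp [Nat.div_div_eq_div_mul, pow_add]

lemma digitBlock_eq_iff {w : List ℕ} (hw : ∀ d ∈ w, d < 2) (n i : ℕ) :
    digitBlock 2 n i w.length = w ↔ n / 2 ^ i % 2 ^ w.length = Nat.ofDigits 2 w.reverse := by
  rw [← ofDigits_digitBlock]
  refine ⟨fun h => by rw [h], fun h => ?_⟩
  refine List.reverse_injective (Nat.ofDigits_inj_of_len_eq one_lt_two ?_ ?_ ?_ h)
  · simp [length_digitBlock]
  · exact fun d hd => lt_of_mem_digitBlock (List.mem_reverse.1 hd)
  · exact fun d hd => hw d (List.mem_reverse.1 hd)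

lemma wordVal_lt (w : AdmissibleWord 2) : wordVal w < 2 ^ w.1.length := by
  have := Nat.ofDigits_lt_base_pow_length (b := 2) (l := w.1.reverse) one_lt_two
    (fun d hd => w.2.2.1 d (List.mem_reverse.1 hd))
  simpa [wordVal] using this

lemma le_wordVal (w : AdmissibleWord 2) : 2 ^ (w.1.length - 1) ≤ wordVal w := by
  obtain ⟨w, h1, h2, h3, h4⟩ := w
  cases w with
  | nil => simp at h1
  | cons a l =>
    have ha : a ≠ 0 := by simpa using h3
    simp only [wordVal, List.reverse_cons, Nat.ofDigits_append, List.length_cons,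
      Nat.add_sub_cancel, List.length_reverse, Nat.ofDigits_singleton]
    have := Nat.le_mul_of_pos_right (2 ^ l.length) (Nat.pos_of_ne_zero ha)
    omega

lemma wordVal_mod_two (w : AdmissibleWord 2) : wordVal w % 2 = 0 := by
  obtain ⟨w, h1, h2, h3, h4⟩ := w
  rcases List.eq_nil_or_concat w with rfl | ⟨l, a, rfl⟩
  · simp at h1
  · have ha : a ≠ 1 := by simpa using h4
    have ha' : a < 2 := h2 a (by simp)
    simp only [wordVal, List.reverse_append, List.reverse_singleton, List.concat_eq_append,
      List.singleton_append, Nat.ofDigits_cons]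
    omega

lemma two_le_length (w : AdmissibleWord 2) : 2 ≤ w.1.length := w.2.1

lemma length_le_iff (w : AdmissibleWord 2) (L : ℕ) : w.1.length ≤ L ↔ wordVal w < 2 ^ L := by
  have h1 := wordVal_lt w
  have h2 := le_wordVal w
  have h3 := two_le_length w
  refine ⟨fun h => h1.trans_le (Nat.pow_le_pow_right two_pos h), fun h => ?_⟩
  have := (Nat.pow_lt_pow_iff_right one_lt_two).1 (h2.trans_lt h)
  omega

/-- The nonzero leading digit lets the value determine the length, and then the digits. -/
lemma wordVal_injective : Function.Injective wordVal := by
  intro v w h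
  have hl : v.1.length = w.1.length := by
    refine le_antisymm ?_ ?_
    · rw [length_le_iff, h]; exact wordVal_lt w
    · rw [length_le_iff, ← h]; exact wordVal_lt v
  refine Subtype.ext (List.reverse_injective (Nat.ofDigits_inj_of_len_eq one_lt_two ?_ ?_ ?_ h))
  · simpa using hl
  · exact fun d hd => v.2.2.1 d (List.mem_reverse.1 hd)
  · exact fun d hd => w.2.2.1 d (List.mem_reverse.1 hd)

lemma exists_wordVal_eq {m : ℕ} (hm : m ≠ 0) (he : m % 2 = 0) : ∃ w, wordVal w = m := by
  have hne : Nat.digits 2 m ≠ [] := Nat.digits_ne_nil_iff_ne_zero.2 hm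
  refine ⟨⟨(Nat.digits 2 m).reverse, ?_, ?_, ?_, ?_⟩, ?_⟩
  · rw [List.length_reverse]
    by_contra! h
    have := Nat.lt_base_pow_length_digits (b := 2) (m := m) one_lt_two
    have := this.trans_le (Nat.pow_le_pow_right two_pos (Nat.lt_succ_iff.1 h))
    omega
  · exact fun d hd => Nat.digits_lt_base one_lt_two (List.mem_reverse.1 hd)
  · rw [List.head?_reverse, List.getLast?_eq_some_getLast hne]
    simpa using Nat.getLast_digit_ne_zero 2 hm
  · rw [List.getLast?_reverse, Nat.digits_def' one_lt_two (Nat.pos_of_ne_zero hm), he]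
    simp
  · simp [wordVal, Nat.ofDigits_digits]

lemma wordVal_wordOneZero : wordVal wordOneZero = 2 := by
  simp [wordVal, wordOneZero, Nat.ofDigits_cons]

lemma length_eq_of_wordVal {w : AdmissibleWord 2} {k : ℕ} (h1 : 2 ^ k ≤ wordVal w)
    (h2 : wordVal w < 2 ^ (k + 1)) : w.1.length = k + 1 :=
  le_antisymm ((length_le_iff w _).2 h2)
    (Nat.succ_le_of_lt (not_le.1 fun h => absurd ((length_le_iff w _).1 h) (not_lt.2 h1)))

lemma factorCount_eq_sum (w : AdmissibleWord 2) {n K : ℕ} (hn : n < 2 ^ K) :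
    factorCount 2 w.1 n =
      ∑ i ∈ Finset.range K, if n / 2 ^ i % 2 ^ w.1.length = wordVal w then 1 else 0 := by
  rw [← Finset.sum_filter, Finset.sum_const, smul_eq_mul, mul_one, factorCount,
    ← Set.ncard_coe_finset]
  congr 1
  ext i
  simp only [digitBlock_eq_iff w.2.2.1, Set.mem_ofPred_eq, Finset.coe_filter, Finset.mem_range]
  refine ⟨fun h => ⟨?_, h⟩, fun h => h.2⟩
  -- Beyond the top digit of `n` the window is all zeros, but an admissible word has positive value.
  by_contra! hi
  rw [Nat.div_eq_of_lt (hn.trans_le (Nat.pow_le_pow_right two_pos hi)), Nat.zero_mod] at h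
  have h1 := le_wordVal w
  have h2 := Nat.two_pow_pos (w.1.length - 1)
  rw [wordVal] at h1
  omega

lemma factorCount_eq_add (w : AdmissibleWord 2) (n : ℕ) :
    factorCount 2 w.1 n =
      factorCount 2 w.1 (n / 2) + if n % 2 ^ w.1.length = wordVal w then 1 else 0 := by
  have hn : n < 2 ^ (n + 1) := Nat.lt_two_pow_self.trans (Nat.pow_lt_pow_succ one_lt_two)
  rw [factorCount_eq_sum w hn, factorCount_eq_sum w (n := n / 2) (K := n)
    (by rw [pow_succ] at hn; omega), Finset.sum_range_succ']
  simp [pow_succ', Nat.div_div_eq_div_mul]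

lemma factorCount_zero (w : AdmissibleWord 2) : factorCount 2 w.1 0 = 0 := by
  rw [factorCount_eq_sum w (K := 0) (by simp)]
  simp

/-- The finite set of admissible words of length at most `L`. -/
noncomputable def wordsUpTo (L : ℕ) : Finset (AdmissibleWord 2) :=
  (Finset.range (2 ^ L)).preimage wordVal wordVal_injective.injOn

lemma mem_wordsUpTo {L : ℕ} {w : AdmissibleWord 2} : w ∈ wordsUpTo L ↔ w.1.length ≤ L := by
  simp [wordsUpTo, length_le_iff]

/-! ### Product formula -/

/-- The factor of the row series contributed by each occurrence of the word `w`. -/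
noncomputable def factorOf (w : AdmissibleWord 2) : PowerSeries ℝ :=
  wordFactor (w.1.length - 1) (wordVal w)

lemma constantCoeff_factorOf (w : AdmissibleWord 2) :
    PowerSeries.constantCoeff (factorOf w) = 1 :=
  constantCoeff_wordFactor _ _

lemma X_pow_dvd_factorOf_sub_one (w : AdmissibleWord 2) :
    PowerSeries.X ^ (w.1.length - 1) ∣ factorOf w - 1 := by
  have h := two_le_length w
  refine X_pow_dvd_wordFactor_sub_one (le_wordVal w) ?_ (wordVal_mod_two w) (by omega)
  rw [Nat.sub_add_cancel (by omega)]
  exact wordVal_lt w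

lemma factorOf_wordOneZero :
    factorOf wordOneZero = 1 + PowerSeries.C 2⁻¹ * PowerSeries.X := by
  rw [factorOf, wordVal_wordOneZero, wordFactor]
  simp [wordOneZero, rowSeries_zero, rowSeries_one, rowSeries_two]

/-- Telescoping by removal of the leading digit: the suffixes of `m` are the suffixes of `m % 2 ^ k`
together with `m` itself, and the factor of the full word is the ratio of `rowSeries m / rowSeries
(m / 2)` to the same quotient for `m % 2 ^ k`. -/
lemma rowSeries_eq_mul_prod_suffix (L k : ℕ) (hk : k ≤ L) : ∀ m < 2 ^ k,
    rowSeries m = rowSeries (m / 2) * ∏ w ∈ wordsUpTo L,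
      if m % 2 ^ w.1.length = wordVal w then factorOf w else 1 := by
  classical
  induction k with
  | zero =>
    intro m hm
    obtain rfl : m = 0 := by simpa using hm
    rw [Finset.prod_eq_one, mul_one]
    intro w _
    rw [if_neg]
    have h1 := le_wordVal w
    have h2 := Nat.two_pow_pos (w.1.length - 1)
    rw [Nat.zero_mod]
    omega
  | succ k ih =>
    intro m hm
    rcases lt_or_ge m (2 ^ k) with hlt | hge
    · exact ih (by omega) m hlt
    rcases Nat.mod_two_eq_zero_or_one m with he | ho
    · obtain ⟨v, hv⟩ := exists_wordVal_eq (m := m) (by have := Nat.two_pow_pos k; omega) he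
      have hvl : v.1.length = k + 1 := length_eq_of_wordVal (by omega) (by omega)
      have hmod : m % 2 ^ k = m - 2 ^ k := by
        rw [Nat.mod_eq_sub_mod hge, Nat.mod_eq_of_lt (by rw [pow_succ] at hm; omega)]
      have hlt : m % 2 ^ k < 2 ^ k := Nat.mod_lt _ (Nat.two_pow_pos k)
      have key : ∀ w ∈ wordsUpTo L,
          (if m % 2 ^ w.1.length = wordVal w then factorOf w else 1) =
            (if w = v then factorOf v else 1) *
            (if m % 2 ^ k % 2 ^ w.1.length = wordVal w then factorOf w else 1) := by
        intro w _
        rcases lt_trichotomy w.1.length (k + 1) with h | h | h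
        · have hw : w ≠ v := by rintro rfl; omega
          rw [if_neg hw, one_mul, Nat.mod_mod_of_dvd _ (pow_dvd_pow 2 (by omega))]
        · have h1 := le_wordVal w
          rw [h, Nat.add_sub_cancel] at h1
          rw [h, Nat.mod_eq_of_lt hm, if_neg (c := m % 2 ^ k % 2 ^ (k + 1) = _), mul_one]
          · by_cases hw : w = v
            · rw [if_pos hw, if_pos (by rw [hw, hv]), hw]
            · rw [if_neg hw, if_neg]
              exact fun hc => hw (wordVal_injective (by rw [hv, ← hc]))
          · rw [Nat.mod_eq_of_lt (hlt.trans (Nat.pow_lt_pow_succ one_lt_two))]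
            omega
        · have hw : w ≠ v := by rintro rfl; omega
          have h1 := le_wordVal w
          have h2 : 2 ^ (k + 1) ≤ 2 ^ (w.1.length - 1) := Nat.pow_le_pow_right two_pos (by omega)
          have h3 := Nat.mod_le m (2 ^ w.1.length)
          have h4 := Nat.mod_le (m % 2 ^ k) (2 ^ w.1.length)
          have h5 := Nat.mod_le m (2 ^ k)
          rw [if_neg hw, if_neg (by omega), if_neg (by omega), one_mul]
      rw [Finset.prod_congr rfl key, Finset.prod_mul_distrib, Finset.prod_ite_eq',
        if_pos (mem_wordsUpTo.2 (by omega))]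
      have h := ih (by omega) _ hlt
      generalize (∏ w ∈ wordsUpTo L,
        if m % 2 ^ k % 2 ^ w.1.length = wordVal w then factorOf w else 1) = P at h ⊢
      rw [factorOf, hvl, hv, wordFactor, Nat.add_sub_cancel]
      have hD := PowerSeries.mul_inv_cancel (rowSeries (m % 2 ^ k) * rowSeries (m / 2))
        (by rw [constantCoeff_mul_rowSeries]; exact one_ne_zero)
      generalize (rowSeries (m % 2 ^ k) * rowSeries (m / 2))⁻¹ = D at hD ⊢
      linear_combination (-rowSeries m) * hD + rowSeries m * rowSeries (m / 2) * D * h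
    -- Admissible words are even, so none is a suffix of an odd `m`; appending 1 does not change the
    -- row series either.
    · rw [Finset.prod_eq_one, mul_one]
      · obtain ⟨l, rfl⟩ : ∃ l, m = 2 * l + 1 := ⟨m / 2, by omega⟩
        rw [rowSeries_two_mul_add_one]
        congr 1
        omega
      · intro w _
        rw [if_neg]
        intro h
        have h1 := congrArg (· % 2) h
        have h2 := two_le_length w
        simp only [wordVal_mod_two] at h1
        rw [Nat.mod_mod_of_dvd _ (dvd_pow_self 2 (by omega))] at h1
        omega

lemma rowSeries_eq_prod (L n : ℕ) (hn : n < 2 ^ L) :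
    rowSeries n = ∏ w ∈ wordsUpTo L, factorOf w ^ factorCount 2 w.1 n := by
  induction n using Nat.strong_induction_on with
  | _ n ih =>
    rcases Nat.eq_zero_or_pos n with rfl | h
    · simp [factorCount_zero, rowSeries_zero]
    · rw [rowSeries_eq_mul_prod_suffix L L le_rfl n hn,
        ih (n / 2) (by omega) (by omega), ← Finset.prod_mul_distrib]
      refine Finset.prod_congr rfl fun w _ => ?_
      rw [factorCount_eq_add w n, pow_add]
      split_ifs <;> simp

lemma dvd_prod_sub_one {R ι : Type*} [CommRing R] (d : R) (s : Finset ι) (f : ι → R)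
    (h : ∀ i ∈ s, d ∣ f i - 1) : d ∣ ∏ i ∈ s, f i - 1 := by
  refine Finset.prod_induction f (fun x => d ∣ x - 1) ?_ (by simp) h
  intro a b ha hb
  have := dvd_add (ha.mul_right b) hb
  rwa [show (a - 1) * b + (b - 1) = a * b - 1 by ring] at this

/-- Words of length greater than `j + 1` contribute factors congruent to 1 modulo `X ^ (j + 1)`. -/
lemma coeff_rowSeries_eq_coeff_prod (j n : ℕ) :
    PowerSeries.coeff j (rowSeries n) =
      PowerSeries.coeff j (∏ w ∈ wordsUpTo (j + 1), factorOf w ^ factorCount 2 w.1 n) := by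
  classical
  have hsub : wordsUpTo (j + 1) ⊆ wordsUpTo (j + 1 + n) := fun w hw => by
    rw [mem_wordsUpTo] at *; omega
  rw [rowSeries_eq_prod (j + 1 + n) n
    (Nat.lt_two_pow_self.trans_le (Nat.pow_le_pow_right two_pos (by omega))),
    ← Finset.prod_sdiff hsub]
  have h : PowerSeries.X ^ (j + 1) ∣ (∏ w ∈ wordsUpTo (j + 1 + n) \ wordsUpTo (j + 1),
      factorOf w ^ factorCount 2 w.1 n) - 1 := by
    refine dvd_prod_sub_one _ _ _ fun w hw => ?_
    rw [Finset.mem_sdiff, mem_wordsUpTo, mem_wordsUpTo] at hw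
    exact ((pow_dvd_pow _ (by omega)).trans (X_pow_dvd_factorOf_sub_one w)).trans
      (sub_one_dvd_pow_sub_one _ _)
  have h' := PowerSeries.X_pow_dvd_iff.1
    (h.mul_right (∏ w ∈ wordsUpTo (j + 1), factorOf w ^ factorCount 2 w.1 n)) j (by omega)
  rwa [sub_mul, one_mul, map_sub, sub_eq_zero] at h'

/-! ### Powers with polynomial exponents and the representing polynomials -/

/-- The coefficient of `X ^ n` in the power `r ^ a`, as a polynomial in the exponent `a`. -/
noncomputable def powCoeff (r : PowerSeries ℝ) (n : ℕ) : Polynomial ℝ :=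
  ∑ k ∈ Finset.range (n + 1),
    Polynomial.C (PowerSeries.coeff n ((r - 1) ^ k) / (k.factorial : ℝ)) * descPochhammer ℝ k

lemma coeff_pow_eq_zero_of_lt {f : PowerSeries ℝ} (hf : PowerSeries.constantCoeff f = 0)
    {n k : ℕ} (h : n < k) : PowerSeries.coeff n (f ^ k) = 0 :=
  PowerSeries.X_pow_dvd_iff.1 (pow_dvd_pow_of_dvd (PowerSeries.X_dvd_iff.2 hf) k) n h

/-- Expand `r ^ m = (1 + (r - 1)) ^ m`. Terms with `k > n` vanish because `X` divides `r - 1`, and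
terms with `k > m` because the binomial coefficient is zero, so both sums extend to a common range.
-/
lemma eval_powCoeff {r : PowerSeries ℝ} (hr : PowerSeries.constantCoeff r = 1) (n m : ℕ) :
    (powCoeff r n).eval (m : ℝ) = PowerSeries.coeff n (r ^ m) := by
  have h0 : PowerSeries.constantCoeff (r - 1) = 0 := by simp [hr]
  have h1 : r ^ m = ∑ k ∈ Finset.range (m + 1),
      PowerSeries.C (m.choose k : ℝ) * (r - 1) ^ k := by
    conv_lhs => rw [← sub_add_cancel r 1, add_pow]
    simp [mul_comm]
  rw [h1, map_sum, powCoeff, Polynomial.eval_finsetSum,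
    Finset.sum_subset (Finset.range_subset_range.2 (show n + 1 ≤ n + m + 1 by omega)),
    Finset.sum_subset (Finset.range_subset_range.2 (show m + 1 ≤ n + m + 1 by omega))]
  · refine Finset.sum_congr rfl fun k _ => ?_
    rw [PowerSeries.coeff_C_mul, Polynomial.eval_mul, Polynomial.eval_C,
      descPochhammer_eval_eq_descFactorial, Nat.descFactorial_eq_factorial_mul_choose]
    have := Nat.cast_ne_zero (R := ℝ).2 k.factorial_ne_zero
    push_cast
    field_simp
  · intro k _ hk
    rw [Nat.choose_eq_zero_of_lt (by simpa using hk)]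
    simp
  · intro k _ hk
    rw [coeff_pow_eq_zero_of_lt h0 (by simpa using hk)]
    simp

lemma natDegree_powCoeff_le (r : PowerSeries ℝ) (n : ℕ) : (powCoeff r n).natDegree ≤ n := by
  refine Polynomial.natDegree_sum_le_of_forall_le _ _ fun k hk => ?_
  refine (Polynomial.natDegree_C_mul_le _ _).trans ?_
  rw [descPochhammer_natDegree]
  exact Nat.lt_succ_iff.1 (Finset.mem_range.1 hk)

lemma powCoeff_one_add (c : ℝ) (n : ℕ) :
    powCoeff (1 + PowerSeries.C c * PowerSeries.X) n =
      Polynomial.C (c ^ n / (n.factorial : ℝ)) * descPochhammer ℝ n := by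
  rw [powCoeff, Finset.sum_eq_single n]
  · simp [mul_pow, ← map_pow, PowerSeries.coeff_C_mul]
  · intro k _ hk
    simp [mul_pow, ← map_pow, PowerSeries.coeff_C_mul, PowerSeries.coeff_X_pow, hk.symm]
  · simp

lemma descPochhammer_eval_neg_one (n : ℕ) :
    (descPochhammer ℝ n).eval (-1) = (-1) ^ n * n.factorial := by
  induction n with
  | zero => simp
  | succ n ih =>
    rw [descPochhammer_succ_eval, ih, Nat.factorial_succ]
    push_cast
    ring

/-- Removing the factor `X` leaves `descPochhammer` shifted by one, whose constant term is its value
at `-1`. -/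
lemma coeff_one_descPochhammer_succ (n : ℕ) :
    (descPochhammer ℝ (n + 1)).coeff 1 = (-1) ^ n * n.factorial := by
  rw [descPochhammer_succ_left, Polynomial.coeff_X_mul, Polynomial.coeff_zero_eq_eval_zero,
    Polynomial.eval_comp, ← descPochhammer_eval_neg_one]
  simp

lemma totalDegree_toMvPolynomial_le {σ : Type*} (i : σ) (p : Polynomial ℝ) :
    (p.toMvPolynomial i).totalDegree ≤ p.natDegree := by
  rw [Polynomial.toMvPolynomial, Polynomial.aeval_eq_sum_range]
  refine MvPolynomial.totalDegree_finsetSum_le fun k hk => ?_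
  refine (MvPolynomial.totalDegree_smul_le _ _).trans ?_
  rw [MvPolynomial.totalDegree_X_pow]
  exact Nat.lt_succ_iff.1 (Finset.mem_range.1 hk)

lemma toMvPolynomial_mem_supported {σ : Type*} {s : Set σ} {i : σ} (hi : i ∈ s)
    (p : Polynomial ℝ) : p.toMvPolynomial i ∈ MvPolynomial.supported ℝ s := by
  rw [Polynomial.toMvPolynomial, Polynomial.aeval_eq_sum_range]
  exact Subalgebra.sum_mem _ fun k _ => Subalgebra.smul_mem _
    (Subalgebra.pow_mem _ (MvPolynomial.X_mem_supported.2 hi) _) _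

/-- Setting all variables but `X i` to zero does not change the coefficients of the powers of
`X i`. -/
lemma coeff_aeval_single {σ : Type*} [DecidableEq σ] (i : σ) (k : ℕ) (P : MvPolynomial σ ℝ) :
    (MvPolynomial.aeval (fun w => if w = i then (Polynomial.X : Polynomial ℝ) else 0) P).coeff k =
      MvPolynomial.coeff (Finsupp.single i k) P := by
  induction P using MvPolynomial.induction_on' with
  | add p q hp hq => rw [map_add, Polynomial.coeff_add, hp, hq, MvPolynomial.coeff_add]
  | monomial s a =>
    rw [MvPolynomial.aeval_monomial, MvPolynomial.coeff_monomial]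
    by_cases hs : s = Finsupp.single i (s i)
    · rw [hs, Finsupp.prod_single_index (by simp), if_pos rfl, Polynomial.algebraMap_eq,
        Polynomial.coeff_C_mul_X_pow]
      simp [(Finsupp.single_injective i).eq_iff, eq_comm]
    · obtain ⟨v, hv, hvi⟩ : ∃ v, s v ≠ 0 ∧ v ≠ i := by
        by_contra! h
        refine hs (Finsupp.ext fun v => ?_)
        by_cases hvi : v = i
        · simp [hvi]
        · rw [Finsupp.single_eq_of_ne hvi]
          by_contra h0
          exact hvi (h v h0)
      rw [Finsupp.prod, Finset.prod_eq_zero (Finsupp.mem_support_iff.2 hv) (by simp [hvi, hv]),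
        mul_zero, Polynomial.coeff_zero, if_neg]
      rintro rfl
      simp at hs

/-- The power series whose specialisations at the factor counts of `n` are the powers
`factorOf w ^ |n|_w`. -/
noncomputable def genericPow (w : AdmissibleWord 2) :
    PowerSeries (MvPolynomial (AdmissibleWord 2) ℝ) :=
  PowerSeries.mk fun n => (powCoeff (factorOf w) n).toMvPolynomial w

/-- The polynomial representing `ϑ₂(j, n) / ϑ₂(0, n)`. -/
noncomputable def rowPoly (j : ℕ) : MvPolynomial (AdmissibleWord 2) ℝ :=
  PowerSeries.coeff j (∏ w ∈ wordsUpTo (j + 1), genericPow w)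

lemma representsRow_rowPoly (j : ℕ) : RepresentsRow 2 j (rowPoly j) := by
  intro n
  rw [← coeff_rowSeries, coeff_rowSeries_eq_coeff_prod, rowPoly, ← PowerSeries.coeff_map, map_prod]
  congr 1
  refine Finset.prod_congr rfl fun w _ => ?_
  ext m
  rw [PowerSeries.coeff_map, genericPow, PowerSeries.coeff_mk, MvPolynomial.eval_toMvPolynomial,
    eval_powCoeff (constantCoeff_factorOf w)]

lemma totalDegree_rowPoly_le (j : ℕ) : (rowPoly j).totalDegree ≤ j := by
  classical
  rw [rowPoly, PowerSeries.coeff_prod]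
  refine MvPolynomial.totalDegree_finsetSum_le fun l hl => ?_
  refine (MvPolynomial.totalDegree_finsetProd _ _).trans ?_
  refine (Finset.sum_le_sum (g := fun w => l w) fun w _ => ?_).trans_eq
    (Finset.mem_finsuppAntidiag.1 hl).1
  rw [genericPow, PowerSeries.coeff_mk]
  exact (totalDegree_toMvPolynomial_le _ _).trans (natDegree_powCoeff_le _ _)

lemma length_le_of_mem_vars_rowPoly (j : ℕ) : ∀ w ∈ (rowPoly j).vars, w.1.length ≤ j + 1 := by
  classical
  suffices h : rowPoly j ∈ MvPolynomial.supported ℝ {w : AdmissibleWord 2 | w.1.length ≤ j + 1} from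
    fun w hw => MvPolynomial.mem_supported.1 h hw
  rw [rowPoly, PowerSeries.coeff_prod]
  refine Subalgebra.sum_mem _ fun l _ => Subalgebra.prod_mem _ fun w hw => ?_
  rw [genericPow, PowerSeries.coeff_mk]
  exact toMvPolynomial_mem_supported (Set.mem_ofPred_eq ▸ mem_wordsUpTo.1 hw) _

/-! ### Restriction to `X_10`: exact degree and the logarithm -/

lemma aeval_rowPoly (j : ℕ) :
    MvPolynomial.aeval (fun w => if w = wordOneZero then (Polynomial.X : Polynomial ℝ) else 0)
      (rowPoly j) = Polynomial.C ((2⁻¹ : ℝ) ^ j / (j.factorial : ℝ)) * descPochhammer ℝ j := by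
  rcases Nat.eq_zero_or_pos j with rfl | hj
  -- For `j = 0` the word `10` is too long to occur in the product.
  · have : wordsUpTo (0 + 1) = ∅ := Finset.eq_empty_of_forall_notMem fun w hw => by
      have h1 := mem_wordsUpTo.1 hw
      have h2 := two_le_length w
      omega
    simp [rowPoly, this]
  rw [← powCoeff_one_add, ← factorOf_wordOneZero, rowPoly]
  have h := PowerSeries.coeff_map (MvPolynomial.aeval (R := ℝ) (fun w =>
    if w = wordOneZero then (Polynomial.X : Polynomial ℝ) else 0)).toRingHom j
    (∏ w ∈ wordsUpTo (j + 1), genericPow w)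
  refine h.symm.trans ?_
  rw [map_prod, Finset.prod_eq_single wordOneZero]
  · simp [genericPow, MvPolynomial.aeval_toMvPolynomial]
  · intro w _ hw
    ext1 m
    simp only [PowerSeries.coeff_map, genericPow, PowerSeries.coeff_mk,
      AlgHom.toRingHom_eq_coe, RingHom.coe_coe, MvPolynomial.aeval_toMvPolynomial, if_neg hw]
    -- A variable set to zero turns its factor into the zeroth power, that is, 1.
    have h0 := eval_powCoeff (constantCoeff_factorOf w) m 0
    rw [Nat.cast_zero, pow_zero, ← Polynomial.coeff_zero_eq_eval_zero] at h0
    rw [← Polynomial.coeff_zero_eq_aeval_zero', h0, PowerSeries.coeff_one, PowerSeries.coeff_one]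
    split_ifs <;> simp
  · intro h
    exact absurd (mem_wordsUpTo.2 (by simp [wordOneZero]; omega)) h

lemma coeff_single_rowPoly (j k : ℕ) :
    MvPolynomial.coeff (Finsupp.single wordOneZero k) (rowPoly j) =
      2⁻¹ ^ j / j.factorial * (descPochhammer ℝ j).coeff k := by
  rw [← coeff_aeval_single, aeval_rowPoly, Polynomial.coeff_C_mul]

lemma totalDegree_rowPoly (j : ℕ) : (rowPoly j).totalDegree = j := by
  refine le_antisymm (totalDegree_rowPoly_le j) ?_
  have h : Finsupp.single wordOneZero j ∈ (rowPoly j).support := by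
    have h1 := (monic_descPochhammer ℝ j).coeff_natDegree
    rw [descPochhammer_natDegree] at h1
    rw [MvPolynomial.mem_support_iff, coeff_single_rowPoly, h1, mul_one]
    positivity
  simpa [Finsupp.sum_single_index] using MvPolynomial.le_totalDegree h

lemma isRowPolynomial_rowPoly (j : ℕ) : IsRowPolynomial 2 j (rowPoly j) :=
  ⟨totalDegree_rowPoly j, length_le_of_mem_vars_rowPoly j, representsRow_rowPoly j⟩

lemma coeff_wordOneZero_rowPoly_succ (j : ℕ) :
    MvPolynomial.coeff (Finsupp.single wordOneZero 1) (rowPoly (j + 1)) =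
      (-1) ^ j * 2⁻¹ ^ (j + 1) / (j + 1) := by
  rw [coeff_single_rowPoly, coeff_one_descPochhammer_succ, Nat.factorial_succ]
  have := Nat.cast_ne_zero (R := ℝ).2 j.factorial_ne_zero
  push_cast
  field_simp

lemma coeff_wordOneZero_rowPoly_zero :
    MvPolynomial.coeff (Finsupp.single wordOneZero 1) (rowPoly 0) = 0 := by
  rw [coeff_single_rowPoly]
  simp [Polynomial.coeff_one]

lemma coeff_logOneAddHalf (j : ℕ) : PowerSeries.coeff j logOneAddHalf =
    MvPolynomial.coeff (Finsupp.single wordOneZero 1) (rowPoly j) := by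
  rw [logOneAddHalf, ← PowerSeries.smul_eq_C_mul, ← PowerSeries.rescale_eq_subst,
    PowerSeries.coeff_rescale, PowerSeries.coeff_log]
  cases j with
  | zero => simp [coeff_wordOneZero_rowPoly_zero]
  | succ j =>
    rw [coeff_wordOneZero_rowPoly_succ, if_neg (Nat.succ_ne_zero j)]
    simp [pow_succ]
    ring

/-- Mercator's series at `-1/2`, reindexed since the coefficient for `j = 0` is zero. `HasSum` in
`ℝ` is unconditional, so it includes absolute convergence. -/
lemma hasSum_coeff_wordOneZero :
    HasSum (fun j => MvPolynomial.coeff (Finsupp.single wordOneZero 1) (rowPoly j))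
      (Real.log (3 / 2)) := by
  rw [← hasSum_nat_add_iff' 1]
  have h := (Real.hasSum_pow_div_log_of_abs_lt_one (x := -2⁻¹)
    (by rw [abs_neg, abs_of_pos] <;> norm_num)).neg
  simp only [Finset.sum_range_one, coeff_wordOneZero_rowPoly_zero, sub_zero,
    coeff_wordOneZero_rowPoly_succ]
  rw [neg_neg, show (1 : ℝ) - -2⁻¹ = 3 / 2 by norm_num] at h
  convert h using 1
  funext j
  rw [neg_pow (2⁻¹ : ℝ), pow_succ (-1 : ℝ)]
  ring

/-! ### Algebraic independence of the factor counts -/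

/-- A polynomial vanishing on an additive submonoid of `σ → ℝ` vanishes on its linear span. -/
lemma eval_eq_zero_of_mem_span {σ : Type*} (A : AddSubmonoid (σ → ℝ)) (Q : MvPolynomial σ ℝ)
    (hA : ∀ a ∈ A, MvPolynomial.eval a Q = 0) {x : σ → ℝ}
    (hx : x ∈ Submodule.span ℝ (A : Set (σ → ℝ))) : MvPolynomial.eval x Q = 0 := by
  -- Allowing every translate `y` makes the property of `x` stable under sums and scalar multiples,
  -- as span induction requires.
  suffices h : ∀ (r : ℝ) (y : σ → ℝ), (∀ a ∈ A, MvPolynomial.eval (a + y) Q = 0) →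
      ∀ a ∈ A, MvPolynomial.eval (a + (y + r • x)) Q = 0 by
    simpa using h 1 0 (by simpa using hA) 0 A.zero_mem
  induction hx using Submodule.span_induction with
  | mem v hv =>
    intro r y hy a ha
    set p : Polynomial ℝ := MvPolynomial.aeval
      (fun i => Polynomial.C ((a + y) i) + Polynomial.C (v i) * Polynomial.X) Q with hp
    have hev : ∀ t : ℝ, p.eval t = MvPolynomial.eval (a + (y + t • v)) Q := by
      intro t
      rw [hp, ← Polynomial.coe_evalRingHom, MvPolynomial.aeval_def, MvPolynomial.hom_eval₂,
        MvPolynomial.eval, MvPolynomial.coe_eval₂Hom]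
      congr 1
      · ext z; simp
      · funext i
        simp only [Polynomial.coe_evalRingHom, Polynomial.eval_add,
          Polynomial.eval_C, Polynomial.eval_mul, Polynomial.eval_X, Pi.add_apply, Pi.smul_apply,
          smul_eq_mul]
        ring
    -- At natural numbers `k` the point `a + k • v` stays in the monoid, so `p` has infinitely many
    -- roots.
    have hzero : p = 0 := by
      refine Polynomial.eq_zero_of_infinite_isRoot p
        ((Set.infinite_range_of_injective (Nat.cast_injective (R := ℝ))).mono ?_)
      rintro _ ⟨k, rfl⟩
      have h := hy (a + k • v) (A.add_mem ha (A.nsmul_mem hv k))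
      rw [← Nat.cast_smul_eq_nsmul ℝ, add_assoc, add_comm _ y] at h
      exact (hev k).trans h
    rw [← hev, hzero, Polynomial.eval_zero]
  | zero => simp
  | add v w _ _ hv hw =>
    intro r y hy a ha
    have h := hw r _ (hv r y hy) a ha
    rwa [add_assoc, ← smul_add] at h
  | smul c v _ hv =>
    intro r y hy a ha
    rw [smul_smul]
    exact hv (r * c) y hy a ha

/-- The `L` low zeros of `m` look like zero padding to every window of length at most `L` that
starts inside `n`, so no new occurrence arises at the junction. -/
lemma factorCount_concat (w : AdmissibleWord 2) {L K m n : ℕ} (hw : w.1.length ≤ L)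
    (hm : 2 ^ L ∣ m) (hn : n < 2 ^ K) :
    factorCount 2 w.1 (2 ^ K * m + n) = factorCount 2 w.1 m + factorCount 2 w.1 n := by
  have hm' : m < 2 ^ m := Nat.lt_two_pow_self
  have hN : 2 ^ K * m + n < 2 ^ (K + m) := by
    rw [pow_add]
    have := Nat.mul_le_mul_left (2 ^ K) (Nat.succ_le_of_lt hm')
    rw [Nat.mul_succ] at this
    omega
  rw [factorCount_eq_sum w hN, factorCount_eq_sum w hm', factorCount_eq_sum w hn,
    Finset.sum_range_add, add_comm]
  congr 1
  · refine Finset.sum_congr rfl fun i _ => ?_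
    rw [pow_add, ← Nat.div_div_eq_div_mul, Nat.mul_add_div (Nat.two_pow_pos K),
      Nat.div_eq_of_lt hn, add_zero]
  · refine Finset.sum_congr rfl fun i hi => ?_
    obtain ⟨d, rfl⟩ := Nat.exists_eq_add_of_lt (Finset.mem_range.1 hi)
    obtain ⟨q, rfl⟩ := (pow_dvd_pow 2 hw).trans hm
    rw [show 2 ^ (i + d + 1) * (2 ^ w.1.length * q) + n =
      2 ^ i * (2 ^ w.1.length * (2 ^ (d + 1) * q)) + n by ring,
      Nat.mul_add_div (Nat.two_pow_pos i), Nat.mul_add_mod]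

/-- Only the window whose top digit is the new leading 1 can add an occurrence. For words longer
than `k + 1` the truncated exponent is 0, and the test fails since the word's value is too large. -/
lemma factorCount_two_pow_add (w : AdmissibleWord 2) (k : ℕ) : ∀ y < 2 ^ k,
    factorCount 2 w.1 (2 ^ k + y) = factorCount 2 w.1 y +
      if (2 ^ k + y) / 2 ^ (k + 1 - w.1.length) = wordVal w then 1 else 0 := by
  have hl := two_le_length w
  have hle := le_wordVal w
  have hev := wordVal_mod_two w
  induction k with
  | zero =>
    intro y hy
    obtain rfl : y = 0 := by simpa using hy
    have h1 : (1 : ℕ) % 2 ^ w.1.length ≠ wordVal w := by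
      have := Nat.mod_le 1 (2 ^ w.1.length)
      have := Nat.pow_le_pow_right two_pos (show 1 ≤ w.1.length - 1 by omega)
      omega
    have h2 : ¬ 1 / 2 ^ (0 + 1 - w.1.length) = wordVal w := by
      have := Nat.div_le_self 1 (2 ^ (0 + 1 - w.1.length))
      have := Nat.pow_le_pow_right two_pos (show 1 ≤ w.1.length - 1 by omega)
      omega
    rw [pow_zero, add_zero, if_neg h2, factorCount_eq_add w 1, if_neg h1]
  | succ k ih =>
    intro y hy
    have hdiv : (2 ^ (k + 1) + y) / 2 = 2 ^ k + y / 2 := by rw [pow_succ]; omega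
    rw [factorCount_eq_add w (2 ^ (k + 1) + y), factorCount_eq_add w y, hdiv,
      ih (y / 2) (by rw [pow_succ] at hy; omega), add_assoc, add_assoc]
    congr 1
    rcases le_or_gt w.1.length (k + 1) with h | h
    · rw [add_comm]
      congr 2
      · obtain ⟨q, hq⟩ := pow_dvd_pow 2 h
        rw [hq, Nat.mul_add_mod]
      · rw [← hdiv, Nat.div_div_eq_div_mul, ← pow_succ',
          show k + 1 + 1 - w.1.length = k + 1 - w.1.length + 1 by omega]
    · have h1 : 2 ^ (k + 1) ≤ 2 ^ (w.1.length - 1) := Nat.pow_le_pow_right two_pos (by omega)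
      have h2 : 2 ^ (k + 1 + 1) ≤ 2 ^ w.1.length := Nat.pow_le_pow_right two_pos (by omega)
      rw [pow_succ] at h2
      rw [show k + 1 - w.1.length = 0 by omega, show k + 1 + 1 - w.1.length = 0 by omega,
        Nat.mod_eq_of_lt (by omega), Nat.mod_eq_of_lt (by omega), pow_zero, Nat.div_one,
        Nat.div_one, if_neg (c := 2 ^ k + y / 2 = _) (by omega), if_neg (c := y = _) (by omega),
        add_comm]

/-- In binary, `a * 2 ^ L - 1` is `a - 1` followed by `L` ones. -/
lemma mul_two_pow_sub_one_div {a L d : ℕ} (ha : a ≠ 0) (hd : d ≤ L) :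
    (a * 2 ^ L - 1) / 2 ^ (L - d) = a * 2 ^ d - 1 := by
  have h1 := Nat.two_pow_pos (L - d)
  have h2 : 0 < a * 2 ^ d := Nat.mul_pos (Nat.pos_of_ne_zero ha) (Nat.two_pow_pos d)
  rw [show a * 2 ^ L = (a * 2 ^ d) * 2 ^ (L - d) by
    rw [mul_assoc, ← pow_add, Nat.add_sub_cancel' hd]]
  obtain ⟨b, hb⟩ := Nat.exists_eq_succ_of_ne_zero h2.ne'
  rw [hb, Nat.succ_mul, Nat.succ_sub_one]
  rw [Nat.add_sub_assoc h1, mul_comm, Nat.mul_add_div h1, Nat.div_eq_of_lt (by omega), add_zero]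

lemma mul_two_pow_sub_one_window {a L l m : ℕ} (ha : a ≠ 0) (hm : m ≤ L) :
    (a * 2 ^ L - 1) * 2 ^ L / 2 ^ (l + 2 * L - m) =
      if m ≤ l then (a - 1) / 2 ^ (l - m) else a * 2 ^ (m - l) - 1 := by
  rw [show l + 2 * L - m = L + (l + L - m) by omega, pow_add, mul_comm (a * 2 ^ L - 1),
    Nat.mul_div_mul_left _ _ (Nat.two_pow_pos L)]
  split_ifs with h
  · have h0 := mul_two_pow_sub_one_div (d := 0) ha (Nat.zero_le L)
    rw [Nat.sub_zero, pow_zero, mul_one] at h0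
    rw [show l + L - m = L + (l - m) by omega, pow_add, ← Nat.div_div_eq_div_mul, h0]
  · rw [show l + L - m = L - (m - l) by omega, mul_two_pow_sub_one_div ha (by omega)]

/-- A combination of factor counts of multiples of `2 ^ L` which detects the word `v`. -/
lemma exists_factorCount_detecting {L : ℕ} (v : AdmissibleWord 2) (hv : v.1.length ≤ L) :
    ∃ a b c d : ℕ, ∀ w : AdmissibleWord 2, w.1.length ≤ L →
      factorCount 2 w.1 (2 ^ L * a) + factorCount 2 w.1 (2 ^ L * b) =
        factorCount 2 w.1 (2 ^ L * c) + factorCount 2 w.1 (2 ^ L * d) +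
          if w = v then 1 else 0 := by
  have hl := two_le_length v
  obtain ⟨l, hvl⟩ := Nat.exists_eq_add_of_le' hl
  have h1 := le_wordVal v
  have h2 := wordVal_lt v
  have h3 := wordVal_mod_two v
  rw [hvl] at h1 h2
  rw [show l + 2 - 1 = l + 1 by omega] at h1
  simp only [pow_succ] at h1 h2
  obtain ⟨u, hu⟩ : ∃ u, wordVal v = 2 * (2 ^ l + u) := ⟨wordVal v / 2 - 2 ^ l, by omega⟩
  have hlt : ∀ t ≤ 2 ^ (l + 1), t ≠ 0 →
      2 ^ L * (t * 2 ^ L - 1) < 2 ^ (l + 1 + 2 * L) := by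
    intro t ht ht0
    have h4 : t * 2 ^ L ≤ 2 ^ (l + 1) * 2 ^ L := Nat.mul_le_mul_right _ ht
    have h5 : 0 < t * 2 ^ L := Nat.mul_pos (Nat.pos_of_ne_zero ht0) (Nat.two_pow_pos L)
    rw [show 2 ^ (l + 1 + 2 * L) = 2 ^ L * (2 ^ (l + 1) * 2 ^ L) by ring]
    exact Nat.mul_lt_mul_of_pos_left (by omega) (Nat.two_pow_pos L)
  have hadd : ∀ t ≠ 0, 2 ^ (l + 1 + 2 * L) + 2 ^ L * (t * 2 ^ L - 1) =
      2 ^ L * ((2 ^ (l + 1) + t) * 2 ^ L - 1) := by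
    intro t ht0
    have h5 : 0 < t * 2 ^ L := Nat.mul_pos (Nat.pos_of_ne_zero ht0) (Nat.two_pow_pos L)
    rw [show 2 ^ (l + 1 + 2 * L) = 2 ^ L * (2 ^ (l + 1) * 2 ^ L) by ring, ← mul_add, add_mul,
      Nat.add_sub_assoc h5]
  -- Write `v = 1u0`, with `u` padded to `l` digits. Followed by `L` zeros, the witnesses read `1u0
  -- 1^L`, `u1 1^L`, `u0 1^L` and `1u1 1^L`. Thus the effect of prepending 1 to `u0 1^L` is compared
  -- with that of prepending it to `u1 1^L`.
  refine ⟨(2 ^ (l + 1) + (2 * u + 1)) * 2 ^ L - 1, (2 * u + 2) * 2 ^ L - 1,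
    (2 * u + 1) * 2 ^ L - 1, (2 ^ (l + 1) + (2 * u + 2)) * 2 ^ L - 1, fun w hw => ?_⟩
  rw [← hadd _ (by omega), ← hadd _ (by omega),
    factorCount_two_pow_add w _ _ (hlt _ (by rw [pow_succ]; omega) (by omega)),
    factorCount_two_pow_add w _ _ (hlt _ (by rw [pow_succ]; omega) (by omega)),
    hadd _ (by omega), hadd _ (by omega), mul_comm (2 ^ L) ((2 ^ (l + 1) + (2 * u + 1)) * 2 ^ L - 1),
    mul_comm (2 ^ L) ((2 ^ (l + 1) + (2 * u + 2)) * 2 ^ L - 1),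
    show l + 1 + 2 * L + 1 - w.1.length = l + 2 + 2 * L - w.1.length by omega,
    mul_two_pow_sub_one_window (by omega) hw, mul_two_pow_sub_one_window (by omega) hw]
  have hw2 := wordVal_mod_two w
  have hwv : w = v ↔ wordVal w = 2 * (2 ^ l + u) := by
    rw [← hu]; exact wordVal_injective.eq_iff.symm
  suffices h : (if (if w.1.length ≤ l + 2 then
      (2 ^ (l + 1) + (2 * u + 1) - 1) / 2 ^ (l + 2 - w.1.length)
      else (2 ^ (l + 1) + (2 * u + 1)) * 2 ^ (w.1.length - (l + 2)) - 1) = wordVal w then 1 else 0) =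
      (if (if w.1.length ≤ l + 2 then
      (2 ^ (l + 1) + (2 * u + 2) - 1) / 2 ^ (l + 2 - w.1.length)
      else (2 ^ (l + 1) + (2 * u + 2)) * 2 ^ (w.1.length - (l + 2)) - 1) = wordVal w then 1 else 0)
      + if w = v then 1 else 0 by omega
  rw [pow_succ]
  -- Shorter top windows agree; at length `l + 2` they are `v` and the inadmissible `1u1`; longer
  -- ones end in 1, so match no admissible word.
  rcases lt_trichotomy w.1.length (l + 2) with h | h | h
  · have hne : w ≠ v := by rintro rfl; omega
    obtain ⟨e, he⟩ : ∃ e, l + 2 - w.1.length = e + 1 := ⟨l + 1 - w.1.length, by omega⟩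
    rw [if_pos h.le, if_pos h.le, if_neg hne, he, pow_succ', ← Nat.div_div_eq_div_mul,
      ← Nat.div_div_eq_div_mul, add_zero]
    congr 3
    omega
  · rw [if_pos h.le, if_pos h.le, h, Nat.sub_self, pow_zero, Nat.div_one, Nat.div_one]
    simp only [hwv]
    rw [if_neg (c := 2 ^ l * 2 + (2 * u + 2) - 1 = _) (by omega), zero_add]
    congr 1
    exact propext (by omega)
  · have hne : w ≠ v := by rintro rfl; omega
    obtain ⟨e, he⟩ : ∃ e, w.1.length - (l + 2) = e + 1 := ⟨w.1.length - (l + 3), by omega⟩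
    have h' : ¬ w.1.length ≤ l + 2 := by omega
    rw [if_neg h', if_neg h', if_neg hne, he, add_zero]
    have hodd : ∀ t ≠ 0, t * 2 ^ (e + 1) - 1 ≠ wordVal w := by
      intro t ht
      have := Nat.mul_pos (Nat.pos_of_ne_zero ht) (Nat.two_pow_pos e)
      rw [pow_succ, ← mul_assoc]
      omega
    rw [if_neg (hodd _ (by omega)), if_neg (hodd _ (by omega))]

/-- The vector of the factor counts of `n`, truncated to the words of length at most `L`. -/
noncomputable def countVector (L n : ℕ) : AdmissibleWord 2 → ℝ :=
  fun w => if w.1.length ≤ L then (factorCount 2 w.1 n : ℝ) else 0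

/-- The truncated count vectors of the multiples of `2 ^ L`. -/
noncomputable def countSubmonoid (L : ℕ) : AddSubmonoid (AdmissibleWord 2 → ℝ) where
  carrier := Set.range fun m => countVector L (2 ^ L * m)
  zero_mem' := ⟨0, by funext w; simp [countVector, factorCount_zero]⟩
  add_mem' := by
    rintro _ _ ⟨a, rfl⟩ ⟨b, rfl⟩
    -- The exponent `2 ^ L * b` is a shift large enough to concatenate without overlap, as `n < 2 ^
    -- n`.
    refine ⟨2 ^ (2 ^ L * b) * a + b, ?_⟩
    funext w
    simp only [countVector, Pi.add_apply]
    split_ifs with hw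
    · rw [show 2 ^ L * (2 ^ (2 ^ L * b) * a + b) = 2 ^ (2 ^ L * b) * (2 ^ L * a) + 2 ^ L * b by ring,
        factorCount_concat w hw (dvd_mul_right _ _) Nat.lt_two_pow_self, Nat.cast_add]
    · simp

lemma single_mem_span_countSubmonoid {L : ℕ} {v : AdmissibleWord 2} (hv : v.1.length ≤ L) :
    Pi.single v 1 ∈ Submodule.span ℝ (countSubmonoid L : Set (AdmissibleWord 2 → ℝ)) := by
  obtain ⟨a, b, c, d, h⟩ := exists_factorCount_detecting v hv
  have hmem : ∀ m, countVector L (2 ^ L * m) ∈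
      Submodule.span ℝ (countSubmonoid L : Set (AdmissibleWord 2 → ℝ)) :=
    fun m => Submodule.subset_span ⟨m, rfl⟩
  have heq : Pi.single v 1 = countVector L (2 ^ L * a) + countVector L (2 ^ L * b) -
      (countVector L (2 ^ L * c) + countVector L (2 ^ L * d)) := by
    funext w
    simp only [countVector, Pi.add_apply, Pi.sub_apply, Pi.single_apply]
    by_cases hw : w.1.length ≤ L
    · have h' := congrArg (Nat.cast : ℕ → ℝ) (h w hw)
      push_cast at h'
      simp only [if_pos hw]
      linarith
    · have hne : w ≠ v := by rintro rfl; exact hw hv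
      simp [hw, hne]
  rw [heq]
  exact Submodule.sub_mem _ (Submodule.add_mem _ (hmem a) (hmem b))
    (Submodule.add_mem _ (hmem c) (hmem d))

lemma eval_eq_of_eqOn_vars {σ : Type*} {Q : MvPolynomial σ ℝ} {x y : σ → ℝ}
    (h : ∀ w ∈ Q.vars, x w = y w) : MvPolynomial.eval x Q = MvPolynomial.eval y Q :=
  MvPolynomial.eval₂Hom_congr' rfl (fun w hw _ => h w hw) rfl

/-- The factor counts are algebraically independent. -/
lemma eq_zero_of_eval_factorCount_eq_zero (Q : MvPolynomial (AdmissibleWord 2) ℝ)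
    (h : ∀ n : ℕ, MvPolynomial.eval (fun w => (factorCount 2 w.1 n : ℝ)) Q = 0) : Q = 0 := by
  set L := Q.vars.sup fun w => w.1.length with hL
  have hvars : ∀ w ∈ Q.vars, w.1.length ≤ L := fun w hw =>
    Finset.le_sup (f := fun w : AdmissibleWord 2 => w.1.length) hw
  refine MvPolynomial.funext fun x => ?_
  -- Only coordinates in `Q.vars` matter, so `x` may be replaced by a finite combination of unit
  -- vectors.
  rw [map_zero, eval_eq_of_eqOn_vars (y := ∑ v ∈ wordsUpTo L, x v • Pi.single v (1 : ℝ))]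
  · refine eval_eq_zero_of_mem_span (countSubmonoid L) Q ?_
      (Submodule.sum_mem _ fun v hv => Submodule.smul_mem _ _
        (single_mem_span_countSubmonoid (mem_wordsUpTo.1 hv)))
    rintro _ ⟨m, rfl⟩
    rw [← h (2 ^ L * m)]
    exact eval_eq_of_eqOn_vars fun w hw => if_pos (hvars w hw)
  · intro w hw
    simp [Finset.sum_apply, Pi.single_apply, mem_wordsUpTo, hvars w hw]

theorem mainTheorem5 :
    ∃ P : ℕ → MvPolynomial (AdmissibleWord 2) ℝ,
      (∀ j : ℕ, IsRowPolynomial 2 j (P j) ∧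
        ∀ Q : MvPolynomial (AdmissibleWord 2) ℝ, RepresentsRow 2 j Q → Q = P j) ∧
      (∀ j : ℕ, MvPolynomial.coeff (Finsupp.single wordOneZero 1) (P j)
        = PowerSeries.coeff j logOneAddHalf) ∧
      HasSum (fun j : ℕ => MvPolynomial.coeff (Finsupp.single wordOneZero 1) (P j))
        (Real.log (3 / 2)) := by
  refine ⟨rowPoly, fun j => ⟨isRowPolynomial_rowPoly j, fun Q hQ => ?_⟩,
    fun j => (coeff_logOneAddHalf j).symm, hasSum_coeff_wordOneZero⟩
  refine sub_eq_zero.1 (eq_zero_of_eval_factorCount_eq_zero _ fun n => ?_)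
  rw [map_sub, hQ n, representsRow_rowPoly j n, sub_self]
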